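/- Let $\alpha,\beta,\theta,\gamma>0$. Let $X=\{X(t):t\ge 0\}$ be a birth and death process on $\mathbb{Z}$ (the length of a double-ended queue with Poisson arrivals of sellers and buyers at rates $\alpha$ and $\beta$ and exponential patience times with rates $\theta$ and $\gamma$), i.e. a continuous-time Markov chain with birth rates $\lambda_i=\alpha+i^-\gamma$ (from $i$ to $i+1$) and death rates $\mu_i=\beta+i^+\theta$ (from $i$ to $i-1$), $i\in\mathbb{Z}$, where $i^+=\max(i,0)$, $i^-=\max(-i,0)$. Let $X(0)$ have an arbitrary distribution with $\mathbb{E}[X(0)^2]<\infty$. Put $m_\pm(t)=\mathbb{E}[X^\pm(t)]$ and $s_\pm(t)=\mathbb{E}[(X^\pm(t))^2]$. For $t,y>0$ let $\Gamma(t,y)=\int_0^y x^{t-1}e^{-x}\,dx$, and let \[ p_1=\frac{\beta}{\theta}\,e^{\alpha/\theta}\Big(\frac{\alpha}{\theta}\Big)^{-\beta/\theta}\,\Gamma\Big(\frac{\beta}{\theta},\frac{\alpha}{\theta}\Big)-1,\qquad p_2=\frac{\alpha}{\gamma}\,e^{\beta/\gamma}\Big(\frac{\beta}{\gamma}\Big)^{-\alpha/\gamma}\,\Gamma\Big(\frac{\alpha}{\gamma},\frac{\beta}{\gamma}\Big)-1.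 \] Then the chain has a unique stationary distribution $\pi=\{\pi_i\}_{i\in\mathbb{Z}}$, which is also its limiting distribution from every starting state, $1+p_1+p_2\neq 0$, and \[ \pi_0=(1+p_1+p_2)^{-1}. \] Moreover $\mathbb{E}[X(t)^2]<\infty$ for all $t\ge 0$, and \begin{align*} \lim_{t\to\infty}m_+(t)&=\Big[\frac{\alpha-\beta}{\theta}p_1+\frac{\alpha}{\theta}\Big]\pi_0,\\ \lim_{t\to\infty}m_-(t)&=\Big[\frac{\beta-\alpha}{\gamma}p_2+\frac{\beta}{\gamma}\Big]\pi_0,\\ \lim_{t\to\infty}s_+(t)&=\frac{\alpha-\beta}{\theta}\lim_{t\to\infty}m_+(t)+\frac{\alpha}{\theta}(p_1+1)\pi_0,\\ \lim_{t\to\infty}s_-(t)&=\frac{\beta-\alpha}{\gamma}\lim_{t\to\infty}m_-(t)+\frac{\beta}{\gamma}(p_2+1)\pi_0. \end{align*} -/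

import Mathlib

open Filter Topology MeasureTheory
open scoped NNReal

/-- The lower incomplete Gamma function `Γ(t, y) = ∫₀^y x^(t-1) e^(-x) dx`. -/
noncomputable def lowerIncompleteGamma (t y : ℝ) : ℝ :=
  ∫ x in (0 : ℝ)..y, x ^ (t - 1) * Real.exp (-x)

/-- A standard stochastic transition function on the countable state space `S`:
`P t i j` is the probability of going from `i` to `j` in time `t`. (Continuity at `0` is part of
the existence of transition rates, see `HasTransitionRates`.) -/
structure IsTransitionFunction {S : Type*} [DecidableEq S] (P : ℝ≥0 → S → S → ℝ) : Prop where
  nonneg : ∀ t i j, 0 ≤ P t i j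
  hasSum_one : ∀ t i, HasSum (P t i) 1
  zero : ∀ i j, P 0 i j = if i = j then 1 else 0
  chapman_kolmogorov : ∀ s t i j, HasSum (fun k => P s i k * P t k j) (P (s + t) i j)

/-- The transition function `P` has the matrix `Q` as its infinitesimal transition rates:
`P h i j = δ i j + Q i j * h + o(h)` as `h` decreases to `0`, for all states `i`, `j`. -/
def HasTransitionRates {S : Type*} (P : ℝ≥0 → S → S → ℝ) (Q : S → S → ℝ) : Prop :=
  ∀ i j, Tendsto (fun h : ℝ≥0 => (P h i j - P 0 i j) / (h : ℝ)) (𝓝[>] 0) (𝓝 (Q i j))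

/-- The rate matrix of the birth and death process on `ℤ` with birth rates `birth i`
(from `i` to `i + 1`) and death rates `death i` (from `i` to `i - 1`). -/
def birthDeathRates (birth death : ℤ → ℝ) (i j : ℤ) : ℝ :=
  if j = i + 1 then birth i
  else if j = i - 1 then death i
  else if j = i then -(birth i + death i)
  else 0

/-- The process `X` is a time-homogeneous continuous-time Markov chain on `S` with transition
function `P` (and arbitrary initial law), in terms of its finite-dimensional distributions. -/
structure IsMarkovChain {S Ω : Type*} [MeasurableSpace S] [MeasurableSpace Ω]
    (P : ℝ≥0 → S → S → ℝ) (X : ℝ≥0 → Ω → S) (ℙ : Measure Ω) : Prop where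
  measurable : ∀ t, Measurable (X t)
  finite_dimensional : ∀ (n : ℕ) (t : ℕ → ℝ≥0), Monotone t → ∀ i : ℕ → S,
    ℙ.real {ω | ∀ k ≤ n, X (t k) ω = i k} =
      ℙ.real {ω | X (t 0) ω = i 0} *
        ∏ k ∈ Finset.range n, P (t (k + 1) - t k) (i k) (i (k + 1))

/-- `π` is a probability distribution on `S` that is stationary for `P`. -/
structure IsStationaryDistribution {S : Type*} (P : ℝ≥0 → S → S → ℝ) (π : S → ℝ) : Prop where
  nonneg : ∀ i, 0 ≤ π i
  hasSum_one : HasSum π 1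
  stationary : ∀ t j, HasSum (fun i => π i * P t i j) (π j)

/-- `π` is a probability distribution on `S` that is the limiting distribution of `P`, whatever
the starting state. -/
structure IsLimitingDistribution {S : Type*} (P : ℝ≥0 → S → S → ℝ) (π : S → ℝ) : Prop where
  nonneg : ∀ i, 0 ≤ π i
  hasSum_one : HasSum π 1
  tendsto : ∀ i j, Tendsto (fun t => P t i j) atTop (𝓝 (π j))

/-- Birth rates `α + i⁻ γ` of the double-ended queue with Poisson arrivals. -/
def queueBirthRate (α γ : ℝ) (i : ℤ) : ℝ := α + ((i⁻ : ℤ) : ℝ) * γ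

/-- Death rates `β + i⁺ θ` of the double-ended queue with Poisson arrivals. -/
def queueDeathRate (β θ : ℝ) (i : ℤ) : ℝ := β + ((i⁺ : ℤ) : ℝ) * θ

/-- `m₊(t) = E[X(t)⁺]`. -/
noncomputable def posMoment {Ω : Type*} [MeasurableSpace Ω] (X : ℝ≥0 → Ω → ℤ) (ℙ : Measure Ω)
    (t : ℝ≥0) : ℝ := ∫ ω, (((X t ω)⁺ : ℤ) : ℝ) ∂ℙ

/-- `m₋(t) = E[X(t)⁻]`. -/
noncomputable def negMoment {Ω : Type*} [MeasurableSpace Ω] (X : ℝ≥0 → Ω → ℤ) (ℙ : Measure Ω)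
    (t : ℝ≥0) : ℝ := ∫ ω, (((X t ω)⁻ : ℤ) : ℝ) ∂ℙ

/-- `s₊(t) = E[(X(t)⁺)²]`. -/
noncomputable def posSecondMoment {Ω : Type*} [MeasurableSpace Ω] (X : ℝ≥0 → Ω → ℤ)
    (ℙ : Measure Ω) (t : ℝ≥0) : ℝ := ∫ ω, (((X t ω)⁺ : ℤ) : ℝ) ^ 2 ∂ℙ

/-- `s₋(t) = E[(X(t)⁻)²]`. -/
noncomputable def negSecondMoment {Ω : Type*} [MeasurableSpace Ω] (X : ℝ≥0 → Ω → ℤ)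
    (ℙ : Measure Ω) (t : ℝ≥0) : ℝ := ∫ ω, (((X t ω)⁻ : ℤ) : ℝ) ^ 2 ∂ℙ

/-!
The proof rests on comparison for the backward equation rather than on path arguments.

Because the rates of each state sum to zero, a bare standard transition function with these rates
satisfies Kolmogorov's backward equation (`hasDerivAt_transition`). Solutions of such equations on
`ℤ`, and more generally bounded-below supersolutions, obey a minimum principle
(`nonneg_of_supersolution`), which has two consequences. First, a drift condition
`Q V ≤ C - c V` bounds the expectation of `V` uniformly in time
(`sum_transition_mul_le_of_drift`); it holds for `V i = i ^ 2` and `V i = i ^ 4`. Second, the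
differences `P t (i + 1) j - P t i j` solve the equation of a birth and death chain which, for the
queue, is killed at rate `θ` on the nonnegative and `γ` on the negative states. They therefore decay
like `exp (-min θ γ * t)`, so the chain forgets its starting point exponentially fast
(`abs_queue_transition_sub_le`).

The detailed-balance weights are summable together with their moments, hence their normalization
`π` is stationary (`hasSum_stationary_of_balance`), and averaging the contraction estimate over `π`
shows that `π` is the limiting distribution, hence the only stationary one. Its normalizing constant
is a series for the incomplete Gamma function, obtained by iterating the recursion
`Γ(t + 1, y) = t Γ(t, y) - y ^ t exp (-y)` (`hasSum_halfWeight`), and its moments follow from the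
balance relation. Bounded fourth moments give the uniform integrability that upgrades convergence in
law to convergence of second moments from a fixed state; the uniform second moment bound then allows
integration over the initial law (`tendsto_integral_of_le_sq`).
-/

/-! ### Transition functions and the backward equation -/

namespace IsTransitionFunction

variable {S : Type*} [DecidableEq S] {P : ℝ≥0 → S → S → ℝ}

theorem le_one (hP : IsTransitionFunction P) (t : ℝ≥0) (i j : S) : P t i j ≤ 1 :=
  le_hasSum (hP.hasSum_one t i) j fun k _ => hP.nonneg t i k

theorem hasSum_increment (hP : IsTransitionFunction P) (h t : ℝ≥0) (i j : S) :
    HasSum (fun k => P h i k * (P t k j - P t i j)) (P (h + t) i j - P t i j) := by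
  have h1 := (hP.chapman_kolmogorov h t i j).sub ((hP.hasSum_one h i).mul_right (P t i j))
  simpa [mul_sub] using h1

/-- The chain leaves `s` in time `h` with probability `1 - ∑ k ∈ s, P h i k`, so this bounds the
error made when the increment of the transition probabilities is computed from `s` alone. -/
theorem abs_increment_sub_sum_le (hP : IsTransitionFunction P) (h t : ℝ≥0) (i j : S)
    (s : Finset S) :
    |P (h + t) i j - P t i j - ∑ k ∈ s, P h i k * (P t k j - P t i j)|
      ≤ 1 - ∑ k ∈ s, P h i k := by
  have h1 : HasSum (fun k : {k // k ∉ s} => P h i k * (P t k j - P t i j))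
      (P (h + t) i j - P t i j - ∑ k ∈ s, P h i k * (P t k j - P t i j)) := by
    rw [Finset.hasSum_compl_iff (f := fun k => P h i k * (P t k j - P t i j)), sub_add_cancel]
    exact hP.hasSum_increment h t i j
  have h2 : HasSum (fun k : {k // k ∉ s} => P h i k) (1 - ∑ k ∈ s, P h i k) := by
    rw [Finset.hasSum_compl_iff (f := fun k => P h i k), sub_add_cancel]
    exact hP.hasSum_one h i
  have hle (k : S) : |P t k j - P t i j| ≤ 1 := by
    rw [abs_le]
    constructor <;> linarith [hP.nonneg t k j, hP.le_one t k j, hP.nonneg t i j, hP.le_one t i j]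
  rw [abs_le]
  constructor
  · refine hasSum_le (fun k => ?_) h2.neg h1
    nlinarith [(abs_le.1 (hle k)).1, hP.nonneg h i k]
  · refine hasSum_le (fun k => ?_) h1 h2
    nlinarith [(abs_le.1 (hle k)).2, hP.nonneg h i k]

theorem tendsto_diag (hP : IsTransitionFunction P) {Q : S → S → ℝ} (hQ : HasTransitionRates P Q)
    (i : S) : Tendsto (fun h => P h i i) (𝓝 0) (𝓝 1) := by
  have h1 : Tendsto (fun h : ℝ≥0 => (P h i i - P 0 i i) / (h : ℝ) * (h : ℝ) + P 0 i i) (𝓝[>] 0)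
      (𝓝 (P 0 i i)) := by
    have h2 : Tendsto (fun h : ℝ≥0 => (h : ℝ)) (𝓝[>] 0) (𝓝 0) := by
      have := (NNReal.continuous_coe.tendsto 0).mono_left (nhdsWithin_le_nhds (s := Set.Ioi 0))
      simpa using this
    simpa using ((hQ i i).mul h2).add_const (P 0 i i)
  have h3 : Tendsto (fun h => P h i i) (𝓝[>] 0) (𝓝 (P 0 i i)) := by
    refine h1.congr' ?_
    filter_upwards [self_mem_nhdsWithin] with h hh
    have : (h : ℝ) ≠ 0 := by exact_mod_cast (ne_of_gt hh)
    field_simp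
    ring
  have h4 : ContinuousWithinAt (fun h => P h i i) (Set.Ici 0) 0 :=
    continuousWithinAt_Ioi_iff_Ici.1 h3
  have h5 : Set.Ici (0 : ℝ≥0) = Set.univ := by ext; simp
  rw [h5, continuousWithinAt_univ] at h4
  simpa [ContinuousAt, hP.zero] using h4

theorem continuous_time (hP : IsTransitionFunction P) {Q : S → S → ℝ}
    (hQ : HasTransitionRates P Q) (i j : S) : Continuous fun t => P t i j := by
  have key (h t : ℝ≥0) : |P (h + t) i j - P t i j| ≤ 1 - P h i i := by
    simpa using hP.abs_increment_sub_sum_le h t i j {i}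
  refine continuous_iff_continuousAt.2 fun t => ?_
  rw [ContinuousAt, tendsto_iff_dist_tendsto_zero]
  have h1 : Tendsto (fun s => 1 - P (nndist s t) i i) (𝓝 t) (𝓝 0) := by
    have h2 : Tendsto (fun s => nndist s t) (𝓝 t) (𝓝 0) := by
      have : Continuous fun s : ℝ≥0 => nndist s t := by fun_prop
      simpa using this.tendsto t
    simpa using ((hP.tendsto_diag hQ i).comp h2).const_sub 1
  refine squeeze_zero (fun _ => dist_nonneg) (fun s => ?_) h1
  have h3 : nndist s t = max (s - t) (t - s) := NNReal.nndist_eq s t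
  rw [Real.dist_eq]
  rcases le_total s t with hst | hst
  · rw [h3, tsub_eq_zero_of_le hst, max_eq_right (zero_le), abs_sub_comm]
    simpa [tsub_add_cancel_of_le hst] using key (t - s) s
  · rw [h3, tsub_eq_zero_of_le hst, max_eq_left (zero_le)]
    simpa [tsub_add_cancel_of_le hst] using key (s - t) t

end IsTransitionFunction

theorem birthDeathRates_succ (b d : ℤ → ℝ) (i : ℤ) : birthDeathRates b d i (i + 1) = b i := by
  simp [birthDeathRates]

theorem birthDeathRates_pred (b d : ℤ → ℝ) (i : ℤ) : birthDeathRates b d i (i - 1) = d i := by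
  have : i - 1 ≠ i + 1 := by lia
  simp [birthDeathRates, this]

theorem birthDeathRates_self (b d : ℤ → ℝ) (i : ℤ) :
    birthDeathRates b d i i = -(b i + d i) := by
  have h1 : i ≠ i + 1 := by lia
  have h2 : i ≠ i - 1 := by lia
  simp [birthDeathRates, h1, h2]

section BackwardEquation

variable {P : ℝ≥0 → ℤ → ℤ → ℝ} {b d : ℤ → ℝ}

/-- Kolmogorov's backward equation for the right derivative. The rates of `i` sum to zero, so the
probability of leaving `{i - 1, i, i + 1}` in time `h` is `o(h)`. -/
theorem tendsto_increment_div (hP : IsTransitionFunction P)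
    (hQ : HasTransitionRates P (birthDeathRates b d)) (t : ℝ≥0) (i j : ℤ) :
    Tendsto (fun h : ℝ≥0 => (P (h + t) i j - P t i j) / (h : ℝ)) (𝓝[>] 0)
      (𝓝 (b i * (P t (i + 1) j - P t i j) + d i * (P t (i - 1) j - P t i j))) := by
  have n1 : i ≠ i + 1 := by lia
  have n2 : i ≠ i - 1 := by lia
  have n3 : i - 1 ≠ i + 1 := by lia
  have hs (f : ℤ → ℝ) : ∑ k ∈ ({i, i - 1, i + 1} : Finset ℤ), f k
      = f i + f (i - 1) + f (i + 1) := by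
    rw [Finset.sum_insert (by simp [n1, n2]), Finset.sum_insert (by simp [n3]),
      Finset.sum_singleton, add_assoc]
  have hb := hQ i (i + 1)
  have hd := hQ i (i - 1)
  have hi := hQ i i
  rw [birthDeathRates_succ] at hb
  rw [birthDeathRates_pred] at hd
  rw [birthDeathRates_self] at hi
  simp only [hP.zero, n1, n2, if_false, if_true, sub_zero] at hb hd hi
  have hmain := (hb.mul_const (P t (i + 1) j - P t i j)).add
    (hd.mul_const (P t (i - 1) j - P t i j))
  have herr : Tendsto (fun h : ℝ≥0 => -((P h i i - 1) / (h : ℝ) + P h i (i - 1) / (h : ℝ) +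
      P h i (i + 1) / (h : ℝ))) (𝓝[>] 0) (𝓝 0) := by
    have := ((hi.add hd).add hb).neg
    rwa [show -(-(b i + d i) + d i + b i) = 0 by ring] at this
  have hdiff : Tendsto (fun h : ℝ≥0 => (P (h + t) i j - P t i j) / (h : ℝ) -
      (P h i (i + 1) / (h : ℝ) * (P t (i + 1) j - P t i j) +
        P h i (i - 1) / (h : ℝ) * (P t (i - 1) j - P t i j))) (𝓝[>] 0) (𝓝 0) := by
    refine squeeze_zero_norm' ?_ herr
    filter_upwards [self_mem_nhdsWithin] with h hh
    have hpos : (0 : ℝ) < h := by exact_mod_cast hh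
    have h1 := hP.abs_increment_sub_sum_le h t i j {i, i - 1, i + 1}
    rw [hs, hs, sub_self, mul_zero, zero_add] at h1
    have h2 := div_le_div_of_nonneg_right h1 hpos.le
    rw [← abs_of_pos hpos, ← abs_div, abs_of_pos hpos] at h2
    rw [Real.norm_eq_abs]
    calc _ = _ := by
          congr 1
          generalize (h : ℝ) = x
          ring
      _ ≤ _ := h2
      _ = _ := by
          generalize (h : ℝ) = x
          ring
  simpa using hdiff.add hmain

theorem continuous_transition (hP : IsTransitionFunction P)
    (hQ : HasTransitionRates P (birthDeathRates b d)) (i j : ℤ) :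
    Continuous fun t : ℝ => P t.toNNReal i j :=
  (hP.continuous_time hQ i j).comp continuous_real_toNNReal

/-- Kolmogorov's backward equation. The right derivative of a transition probability is
continuous, hence it is a two-sided derivative at positive times. -/
theorem hasDerivAt_transition (hP : IsTransitionFunction P)
    (hQ : HasTransitionRates P (birthDeathRates b d)) (i j : ℤ) {t : ℝ} (ht : 0 < t) :
    HasDerivAt (fun t : ℝ => P t.toNNReal i j)
      (b i * (P t.toNNReal (i + 1) j - P t.toNNReal i j) +
        d i * (P t.toNNReal (i - 1) j - P t.toNNReal i j)) t := by
  set g : ℝ → ℝ := fun t => b i * (P t.toNNReal (i + 1) j - P t.toNNReal i j) +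
        d i * (P t.toNNReal (i - 1) j - P t.toNNReal i j) with hg
  have hgc : Continuous g := by
    have h0 := continuous_transition hP hQ i j
    have h1 := continuous_transition hP hQ (i + 1) j
    have h2 := continuous_transition hP hQ (i - 1) j
    exact ((h1.sub h0).const_mul _).add ((h2.sub h0).const_mul _)
  have hright (x : ℝ) (hx : 0 ≤ x) :
      HasDerivWithinAt (fun t : ℝ => P t.toNNReal i j) (g x) (Set.Ioi x) x := by
    rw [hasDerivWithinAt_iff_tendsto_slope' (by simp)]
    have h1 : Tendsto (fun y : ℝ => (y - x).toNNReal) (𝓝[>] x) (𝓝[>] 0) := by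
      refine tendsto_nhdsWithin_iff.2 ⟨?_, ?_⟩
      · have : Continuous fun y : ℝ => (y - x).toNNReal := by fun_prop
        have h2 := (this.tendsto x).mono_left (nhdsWithin_le_nhds (s := Set.Ioi x))
        simpa using h2
      · filter_upwards [self_mem_nhdsWithin] with y hy
        simpa using hy
    refine ((tendsto_increment_div hP hQ x.toNNReal i j).comp h1).congr' ?_
    filter_upwards [self_mem_nhdsWithin] with y hy
    have hy' : 0 ≤ y - x := sub_nonneg.2 (le_of_lt hy)
    have h3 : (y - x).toNNReal + x.toNNReal = y.toNNReal := by
      rw [← Real.toNNReal_add hy' hx, sub_add_cancel]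
    simp only [Function.comp, slope_def_field, h3, Real.coe_toNNReal _ hy']
  have hint : ∀ y : ℝ, 0 ≤ y → P 0 i j + ∫ x in (0 : ℝ)..y, g x = P y.toNNReal i j := by
    intro y hy
    have := intervalIntegral.integral_eq_sub_of_hasDeriv_right (a := 0) (b := y)
      (continuous_transition hP hQ i j).continuousOn (f' := g)
      (fun x hx => hright x (by rw [min_eq_left hy] at hx; exact hx.1.le))
      (hgc.intervalIntegrable 0 y)
    rw [this]
    simp
  have hder : HasDerivAt (fun y : ℝ => P 0 i j + ∫ x in (0 : ℝ)..y, g x) (g t) t :=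
    (hgc.integral_hasStrictDerivAt 0 t).hasDerivAt.const_add _
  refine hder.congr_of_eventuallyEq ?_
  filter_upwards [lt_mem_nhds ht] with y hy
  exact (hint y hy.le).symm

end BackwardEquation

/-! ### A maximum principle -/

/-- Minimum principle for the operator `(Q w) i = l i * w (i + 1) + m i * w (i - 1) - k i * w i`
on `ℤ`: a supersolution of `w' = Q w` that is bounded below and initially nonnegative stays
nonnegative. The coercive function `V` keeps the negative minimum of a perturbation of `w` in a
finite set of states. -/
theorem nonneg_of_supersolution {l m k V : ℤ → ℝ} {K M : ℝ} {w w' : ℝ → ℤ → ℝ}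
    (hl : ∀ i, 0 ≤ l i) (hm : ∀ i, 0 ≤ m i) (hk : ∀ i, l i + m i ≤ k i)
    (hV : Tendsto V cofinite atTop) (hV0 : ∀ i, 0 < V i) (hK : 0 ≤ K)
    (hKV : ∀ i, l i * V (i + 1) + m i * V (i - 1) - k i * V i < K * V i)
    (hcont : ∀ i, Continuous fun t => w t i)
    (hder : ∀ i t, 0 < t → HasDerivAt (fun t => w t i) (w' t i) t)
    (hsup : ∀ i t, 0 < t → l i * w t (i + 1) + m i * w t (i - 1) - k i * w t i ≤ w' t i)
    (hbdd : ∀ i t, 0 ≤ t → -M ≤ w t i) (h0 : ∀ i, 0 ≤ w 0 i) :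
    ∀ i t, 0 ≤ t → 0 ≤ w t i := by
  intro i₀ T hT
  by_contra! hneg
  have hE : 0 < Real.exp (K * T) * V i₀ := mul_pos (Real.exp_pos _) (hV0 _)
  obtain ⟨ε, hε, hε'⟩ : ∃ ε > 0, w T i₀ + ε * (Real.exp (K * T) * V i₀) < 0 := by
    refine ⟨-(w T i₀) / (2 * (Real.exp (K * T) * V i₀)), by
      apply div_pos <;> linarith, ?_⟩
    have : -(w T i₀) / (2 * (Real.exp (K * T) * V i₀)) * (Real.exp (K * T) * V i₀)
        = -(w T i₀) / 2 := by
      have := hE.ne'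
      generalize Real.exp (K * T) * V i₀ = E at *
      field_simp
    linarith
  -- `exp (K t) V` is a strict supersolution, so `z` cannot have a negative minimum
  set z : ℝ → ℤ → ℝ := fun t i => w t i + ε * (Real.exp (K * t) * V i) with hz
  have hfin : {i | ε * V i < M}.Finite := by
    have := (hV.const_mul_atTop hε).eventually_ge_atTop M
    simpa only [Filter.eventually_cofinite, not_le] using this
  have hout : ∀ i t, 0 ≤ t → z t i < 0 → i ∈ {i | ε * V i < M} := by
    intro i t ht hzi
    by_contra hi
    simp only [Set.mem_ofPred_eq, not_lt] at hi
    have h1 : 1 ≤ Real.exp (K * t) := Real.one_le_exp (by positivity)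
    have h2 : V i ≤ Real.exp (K * t) * V i := le_mul_of_one_le_left (hV0 i).le h1
    have h3 := mul_le_mul_of_nonneg_left h2 hε.le
    have := hbdd i t ht
    simp only [hz] at hzi
    linarith
  have hzc : ContinuousOn (fun p : ℝ × ℤ => z p.1 p.2)
      (Set.Icc 0 T ×ˢ {i | ε * V i < M}) := by
    rw [continuousOn_prod_of_discrete_right]
    intro i
    have := hcont i
    exact Continuous.continuousOn (by simp only [hz]; fun_prop)
  have hmem : (T, i₀) ∈ Set.Icc 0 T ×ˢ {i | ε * V i < M} :=
    ⟨⟨hT, le_rfl⟩, hout i₀ T hT hε'⟩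
  obtain ⟨⟨t, i⟩, ⟨⟨ht0, htT⟩, hi⟩, hmin⟩ :=
    (isCompact_Icc.prod hfin.isCompact).exists_isMinOn ⟨_, hmem⟩ hzc
  simp only at ht0 htT hi
  have hzneg : z t i < 0 := (hmin hmem).trans_lt hε'
  have hglobal : ∀ s j, 0 ≤ s → s ≤ T → z t i ≤ z s j := by
    intro s j hs hsT
    rcases lt_or_ge (z s j) 0 with h | h
    · exact hmin (show (s, j) ∈ _ from ⟨⟨hs, hsT⟩, hout j s hs h⟩)
    · exact hzneg.le.trans h
  have htpos : 0 < t := by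
    rcases ht0.lt_or_eq with h | h
    · exact h
    · rw [← h] at hzneg
      have := h0 i
      have := hV0 i
      have : 0 < ε * (Real.exp (K * 0) * V i) := by positivity
      simp only [hz] at hzneg
      linarith
  have hzder : HasDerivAt (fun s => z s i)
      (w' t i + ε * (Real.exp (K * t) * (K * 1) * V i)) t :=
    (hder i t htpos).add
      ((((((hasDerivAt_id t).const_mul K).exp)).mul_const (V i)).const_mul ε)
  -- the minimum may be attained at the right endpoint, so only a left derivative is available
  have hle : w' t i + ε * (Real.exp (K * t) * (K * 1) * V i) ≤ 0 := by
    have h1 := (hasDerivWithinAt_iff_tendsto_slope' (by simp)).1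
      (hzder.hasDerivWithinAt (s := Set.Iio t))
    refine le_of_tendsto h1 ?_
    filter_upwards [Ioo_mem_nhdsLT htpos] with s hs
    rw [slope_def_field]
    exact div_nonpos_of_nonneg_of_nonpos
      (sub_nonneg.2 (hglobal s i hs.1.le (hs.2.le.trans htT))) (by linarith [hs.2])
  have hL := hsup i t htpos
  have hKi := mul_lt_mul_of_pos_left (hKV i) (mul_pos hε (Real.exp_pos (K * t)))
  have hz1 := mul_le_mul_of_nonneg_left (hglobal t (i + 1) ht0 htT) (hl i)
  have hz2 := mul_le_mul_of_nonneg_left (hglobal t (i - 1) ht0 htT) (hm i)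
  have hz3 : 0 ≤ (l i + m i - k i) * z t i :=
    mul_nonneg_of_nonpos_of_nonpos (by linarith [hk i]) hzneg.le
  simp only [hz] at hz1 hz2 hz3
  linarith

/-! ### Lyapunov bounds and contraction for birth and death chains -/

section BirthDeath

variable {P : ℝ≥0 → ℤ → ℤ → ℝ} {b d : ℤ → ℝ}

/-- Foster–Lyapunov moment bound: a drift `Q V ≤ C - c V` bounds the expectation of `V` uniformly
in time. The minimum principle is applied to `exp (-c t) (V - C / c) + C / c` minus the expectation
of a truncation of `V`. -/
theorem sum_transition_mul_le_of_drift (hP : IsTransitionFunction P)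
    (hQ : HasTransitionRates P (birthDeathRates b d)) (hb : ∀ i, 0 ≤ b i) (hd : ∀ i, 0 ≤ d i)
    {V : ℤ → ℝ} {C c : ℝ} (hV : Tendsto V cofinite atTop) (hV0 : ∀ i, 0 ≤ V i) (hC : 0 ≤ C)
    (hc : 0 < c) (hdrift : ∀ i, b i * (V (i + 1) - V i) + d i * (V (i - 1) - V i) ≤ C - c * V i)
    (F : Finset ℤ) (t : ℝ≥0) (i : ℤ) : ∑ j ∈ F, P t i j * V j ≤ V i + C / c := by
  set u : ℝ → ℤ → ℝ := fun t i => ∑ j ∈ F, P t.toNNReal i j * V j with hu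
  have hu0 : ∀ t i, u t i ≤ ∑ j ∈ F, V j := fun t i =>
    Finset.sum_le_sum fun j _ => mul_le_of_le_one_left (hV0 j) (hP.le_one _ _ _)
  have hcC : 0 ≤ C / c := by positivity
  have huc : ∀ i, Continuous fun t => u t i := fun i =>
    continuous_finsetSum _ fun j _ => (continuous_transition hP hQ i j).mul_const _
  have hud : ∀ i t, 0 < t → HasDerivAt (fun t => u t i)
      (b i * (u t (i + 1) - u t i) + d i * (u t (i - 1) - u t i)) t := by
    intro i t ht
    have h1 := HasDerivAt.fun_sum (u := F) fun j _ =>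
      (hasDerivAt_transition hP hQ i j ht).mul_const (V j)
    refine h1.congr_deriv ?_
    simp only [hu, ← Finset.sum_sub_distrib, Finset.mul_sum, ← Finset.sum_add_distrib]
    exact Finset.sum_congr rfl fun j _ => by ring
  -- `V + 1` serves as the coercive function: `Q (V + 1) ≤ C < (C + 1) (V + 1)`
  have key := nonneg_of_supersolution (l := b) (m := d) (k := fun i => b i + d i)
    (V := fun i => V i + 1) (K := C + 1) (M := ∑ j ∈ F, V j)
    (w := fun t i => Real.exp (-c * t) * (V i - C / c) + C / c - u t i)
    (w' := fun t i => Real.exp (-c * t) * (-c * 1) * (V i - C / c) -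
      (b i * (u t (i + 1) - u t i) + d i * (u t (i - 1) - u t i)))
    hb hd (fun _ => le_rfl) (tendsto_atTop_add_const_right _ _ hV)
    (fun i => by linarith [hV0 i]) (by linarith)
    (fun i => by nlinarith [hdrift i, hV0 i, mul_nonneg hc.le (hV0 i), mul_nonneg hC (hV0 i)])
    (fun i => by have := huc i; fun_prop)
    (fun i t ht => ((((((hasDerivAt_id t).const_mul (-c)).exp)).mul_const (V i - C / c)).add_const
      (C / c)).sub (hud i t ht))
    (fun i t ht => by
      have h2 := mul_le_mul_of_nonneg_left (hdrift i) (Real.exp_pos (-c * t)).le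
      have h3 : c * (C / c) = C := mul_div_cancel₀ C hc.ne'
      have h4 : Real.exp (-c * t) * (-c * 1) * (V i - C / c)
          = Real.exp (-c * t) * (c * (C / c) - c * V i) := by ring
      rw [h4, h3]
      linarith)
    (fun i t ht => by
      have h1 := mul_nonneg (Real.exp_pos (-c * t)).le (hV0 i)
      have h2 := mul_le_mul_of_nonneg_right
        (Real.exp_le_one_iff.2 (by nlinarith) : Real.exp (-c * t) ≤ 1) hcC
      linarith [hu0 t i])
    (fun i => by
      have h1 : u 0 i ≤ V i := by
        simp only [hu, Real.toNNReal_zero, hP.zero, ite_mul, one_mul, zero_mul,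
          Finset.sum_ite_eq]
        split_ifs
        · exact le_rfl
        · exact hV0 i
      simp only [mul_zero, Real.exp_zero, one_mul]
      linarith)
    i t t.2
  have h1 : Real.exp (-c * t) ≤ 1 := Real.exp_le_one_iff.2 (by nlinarith [t.2, t.coe_nonneg])
  have h2 := mul_le_mul_of_nonneg_right h1 (hV0 i)
  have h3 := mul_nonneg (Real.exp_pos (-c * t)).le hcC
  simp only [hu, Real.toNNReal_coe] at key
  linarith

/-- The differences `P t (i + 1) j - P t i j` solve the backward equation of a birth and death
chain that is killed at rate at least `c`. -/
theorem abs_transition_succ_sub_le (hP : IsTransitionFunction P)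
    (hQ : HasTransitionRates P (birthDeathRates b d)) (hb : ∀ i, 0 ≤ b i) (hd : ∀ i, 0 ≤ d i)
    {V : ℤ → ℝ} {K c : ℝ} (hV : Tendsto V cofinite atTop) (hV0 : ∀ i, 0 < V i) (hK : 0 ≤ K)
    (hc : 0 ≤ c) (hkill : ∀ i, b (i + 1) + d i + c ≤ b i + d (i + 1))
    (hKV : ∀ i, b (i + 1) * V (i + 1) + d i * V (i - 1) - (b i + d (i + 1)) * V i < K * V i)
    (t : ℝ≥0) (i j : ℤ) : |P t (i + 1) j - P t i j| ≤ Real.exp (-c * t) := by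
  set u : ℝ → ℤ → ℝ := fun t i => P t.toNNReal (i + 1) j - P t.toNNReal i j with hu
  have hu1 : ∀ t i, |u t i| ≤ 1 := fun t i => by
    rw [abs_le]
    constructor <;> linarith [hP.nonneg t.toNNReal (i + 1) j, hP.le_one t.toNNReal (i + 1) j,
      hP.nonneg t.toNNReal i j, hP.le_one t.toNNReal i j]
  -- `σ = 1` and `σ = -1` give the two bounds
  have key : ∀ σ : ℝ, |σ| ≤ 1 → 0 ≤ Real.exp (-c * t) - σ * u t i := by
    intro σ hσ
    have hσu : ∀ t i, σ * u t i ≤ 1 := fun t i => by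
      refine (le_abs_self _).trans ?_
      rw [abs_mul]
      exact mul_le_one₀ hσ (abs_nonneg _) (hu1 t i)
    refine nonneg_of_supersolution (l := fun i => b (i + 1)) (m := d)
      (k := fun i => b i + d (i + 1)) (V := V) (K := K) (M := 1)
      (w := fun t i => Real.exp (-c * t) - σ * u t i)
      (w' := fun t i => Real.exp (-c * t) * (-c * 1) - σ *
        ((b (i + 1) * (P t.toNNReal (i + 1 + 1) j - P t.toNNReal (i + 1) j) +
          d (i + 1) * (P t.toNNReal (i + 1 - 1) j - P t.toNNReal (i + 1) j)) -
        (b i * (P t.toNNReal (i + 1) j - P t.toNNReal i j) +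
          d i * (P t.toNNReal (i - 1) j - P t.toNNReal i j))))
      (fun i => hb _) hd (fun i => by linarith [hkill i]) hV hV0 hK hKV
      (fun i => ?_) (fun i t ht => ?_) (fun i t ht => ?_) (fun i t ht => ?_) (fun i => ?_) i t t.2
    · have h1 := continuous_transition hP hQ i j
      have h2 := continuous_transition hP hQ (i + 1) j
      have h3 : Continuous fun t => u t i := h2.sub h1
      fun_prop
    · exact (((hasDerivAt_id t).const_mul (-c)).exp).sub
        (((hasDerivAt_transition hP hQ (i + 1) j ht).sub
          (hasDerivAt_transition hP hQ i j ht)).const_mul σ)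
    · have h1 := mul_le_mul_of_nonneg_left (hkill i) (Real.exp_pos (-c * t)).le
      simp only [hu, add_sub_cancel_right, sub_add_cancel]
      linarith
    · linarith [hσu t i, Real.exp_pos (-c * t)]
    · simpa using hσu 0 i
  have h1 := key 1 (by simp)
  have h2 := key (-1) (by simp)
  simp only [hu, Real.toNNReal_coe] at h1 h2
  rw [abs_le]
  constructor <;> linarith

/-- A function on `ℤ` whose increments are bounded by `B` is `B`-Lipschitz. -/
theorem abs_sub_le_of_abs_succ_sub_le {f : ℤ → ℝ} {B : ℝ} (h : ∀ i, |f (i + 1) - f i| ≤ B)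
    (i k : ℤ) : |f i - f k| ≤ B * |(i : ℝ) - k| := by
  have hn : ∀ (n : ℕ) (k : ℤ), |f (k + n) - f k| ≤ B * n := by
    intro n k
    induction n with
    | zero => simp
    | succ n ih =>
      have h1 := h (k + n)
      have h2 := abs_sub_le (f (k + n + 1)) (f (k + n)) (f k)
      push_cast
      rw [← add_assoc]
      linarith
  rcases le_total k i with hki | hki
  · obtain ⟨n, rfl⟩ := Int.le.dest hki
    simpa using hn n k
  · obtain ⟨n, rfl⟩ := Int.le.dest hki
    rw [abs_sub_comm]
    simpa using hn n i

end BirthDeath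

/-! ### Rates of the double-ended queue -/

section Queue

variable {α β θ γ : ℝ}

theorem queueBirthRate_natCast (α γ : ℝ) (n : ℕ) : queueBirthRate α γ n = α := by
  simp [queueBirthRate]

theorem queueBirthRate_neg_natCast (α γ : ℝ) (n : ℕ) : queueBirthRate α γ (-n) = α + n * γ := by
  simp [queueBirthRate]

theorem queueDeathRate_natCast (β θ : ℝ) (n : ℕ) : queueDeathRate β θ n = β + n * θ := by
  simp [queueDeathRate]

theorem queueDeathRate_neg_natCast (β θ : ℝ) (n : ℕ) : queueDeathRate β θ (-n) = β := by
  simp [queueDeathRate]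

theorem queueBirthRate_pos (hα : 0 < α) (hγ : 0 < γ) (i : ℤ) : 0 < queueBirthRate α γ i := by
  have : (0 : ℝ) ≤ ((i⁻ : ℤ) : ℝ) := by exact_mod_cast negPart_nonneg i
  unfold queueBirthRate
  positivity

theorem queueDeathRate_pos (hβ : 0 < β) (hθ : 0 < θ) (i : ℤ) : 0 < queueDeathRate β θ i := by
  have : (0 : ℝ) ≤ ((i⁺ : ℤ) : ℝ) := by exact_mod_cast posPart_nonneg i
  unfold queueDeathRate
  positivity

theorem tendsto_intCast_pow_cofinite {k : ℕ} (hk : k ≠ 0) (hk' : Even k) :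
    Tendsto (fun i : ℤ => (i : ℝ) ^ k) cofinite atTop := by
  have h1 : Tendsto (fun i : ℤ => |(i : ℝ)|) cofinite atTop := by
    have := tendsto_norm_cocompact_atTop.comp Int.tendsto_coe_cofinite
    simpa [Function.comp_def] using this
  refine ((tendsto_pow_atTop hk).comp h1).congr fun i => ?_
  simp [hk'.pow_abs]

/-- Both half-lines of the queue reduce to the same inequality, with the roles of arrivals of
sellers and buyers exchanged on the negative one. -/
theorem queue_drift_le {V : ℤ → ℝ} {C c : ℝ} (hV : ∀ i, V (-i) = V i)
    (hpos : ∀ n : ℕ, α * (V (n + 1) - V n) + (β + n * θ) * (V (n - 1) - V n) ≤ C - c * V n)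
    (hneg : ∀ n : ℕ, β * (V (n + 1) - V n) + (α + n * γ) * (V (n - 1) - V n) ≤ C - c * V n)
    (i : ℤ) : queueBirthRate α γ i * (V (i + 1) - V i) +
      queueDeathRate β θ i * (V (i - 1) - V i) ≤ C - c * V i := by
  obtain ⟨n, rfl | rfl⟩ := i.eq_nat_or_neg
  · rw [queueBirthRate_natCast, queueDeathRate_natCast]
    exact hpos n
  · rw [queueBirthRate_neg_natCast, queueDeathRate_neg_natCast, hV,
      show -(n : ℤ) + 1 = -(n - 1) by ring, show -(n : ℤ) - 1 = -(n + 1) by ring, hV, hV]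
    linarith [hneg n]

theorem exists_sq_drift (hα : 0 < α) (hβ : 0 < β) (hθ : 0 < θ) :
    ∃ C, 0 ≤ C ∧ ∀ x : ℝ, 0 ≤ x →
      α * ((x + 1) ^ 2 - x ^ 2) + (β + x * θ) * ((x - 1) ^ 2 - x ^ 2) ≤ C - θ * x ^ 2 := by
  refine ⟨(2 * α + θ) ^ 2 / (4 * θ) + α + β, by positivity, fun x hx => ?_⟩
  have h1 : (2 * α + θ) * x ≤ θ * x ^ 2 + (2 * α + θ) ^ 2 / (4 * θ) := by
    have h2 : θ * x ^ 2 + (2 * α + θ) ^ 2 / (4 * θ) - (2 * α + θ) * x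
        = (2 * θ * x - (2 * α + θ)) ^ 2 / (4 * θ) := by
      field_simp
      ring
    have h3 : 0 ≤ (2 * θ * x - (2 * α + θ)) ^ 2 / (4 * θ) := by positivity
    linarith
  nlinarith [mul_nonneg hβ.le hx]

theorem exists_pow_four_drift (hα : 0 < α) (hβ : 0 < β) (hθ : 0 < θ) :
    ∃ C, 0 ≤ C ∧ ∀ x : ℝ, 0 ≤ x →
      α * ((x + 1) ^ 4 - x ^ 4) + (β + x * θ) * ((x - 1) ^ 4 - x ^ 4) ≤ C - θ * x ^ 4 := by
  obtain ⟨K, hK⟩ : ∃ K, K = 15 * α + 7 * β + 7 * θ := ⟨_, rfl⟩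
  have hK0 : 0 < K := by rw [hK]; positivity
  refine ⟨K + K * (K / (3 * θ)) ^ 3, by positivity, fun x hx => ?_⟩
  have h2 : x ^ 2 ≤ 1 + x ^ 3 := by nlinarith [mul_nonneg hx (sq_nonneg (x - 1)), sq_nonneg (x - 1)]
  have h1 : x ≤ 1 + x ^ 3 := by nlinarith [mul_nonneg hx (sq_nonneg (x - 1)), sq_nonneg (x - 1)]
  -- the cubic term is absorbed by the quartic one beyond `x = K / (3 θ)`
  have h3 : K * x ^ 3 ≤ 3 * θ * x ^ 4 + K * (K / (3 * θ)) ^ 3 := by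
    rcases le_total x (K / (3 * θ)) with h | h
    · have := mul_le_mul_of_nonneg_left (pow_le_pow_left₀ hx h 3) hK0.le
      have : 0 ≤ 3 * θ * x ^ 4 := by positivity
      linarith
    · have h4 : K ≤ x * (3 * θ) := (div_le_iff₀ (by positivity)).1 h
      have h5 := mul_le_mul_of_nonneg_right h4 (pow_nonneg hx 3)
      have : 0 ≤ K * (K / (3 * θ)) ^ 3 := by positivity
      nlinarith
  have h4 : α * ((x + 1) ^ 4 - x ^ 4) ≤ α * (15 * (1 + x ^ 3)) :=
    mul_le_mul_of_nonneg_left (by nlinarith [pow_nonneg hx 3]) hα.le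
  have h5 : β * ((x - 1) ^ 4 - x ^ 4) ≤ β * (7 * (1 + x ^ 3)) :=
    mul_le_mul_of_nonneg_left (by nlinarith [pow_nonneg hx 3]) hβ.le
  have h6 : θ * (x * ((x - 1) ^ 4 - x ^ 4) + 4 * x ^ 4) ≤ θ * (7 * (1 + x ^ 3)) :=
    mul_le_mul_of_nonneg_left (by nlinarith [pow_nonneg hx 3, sq_nonneg x]) hθ.le
  subst hK
  nlinarith

theorem exists_queue_drift {k : ℕ} (hk : Even k)
    (hdrift : ∀ {α β θ : ℝ}, 0 < α → 0 < β → 0 < θ → ∃ C, 0 ≤ C ∧ ∀ x : ℝ, 0 ≤ x →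
      α * ((x + 1) ^ k - x ^ k) + (β + x * θ) * ((x - 1) ^ k - x ^ k) ≤ C - θ * x ^ k)
    (hα : 0 < α) (hβ : 0 < β) (hθ : 0 < θ) (hγ : 0 < γ) :
    ∃ C c : ℝ, 0 ≤ C ∧ 0 < c ∧ ∀ i : ℤ,
      queueBirthRate α γ i * (((i + 1 : ℤ) : ℝ) ^ k - (i : ℝ) ^ k) +
        queueDeathRate β θ i * (((i - 1 : ℤ) : ℝ) ^ k - (i : ℝ) ^ k) ≤ C - c * (i : ℝ) ^ k := by
  obtain ⟨C₁, hC₁, h₁⟩ := hdrift hα hβ hθ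
  obtain ⟨C₂, hC₂, h₂⟩ := hdrift hβ hα hγ
  refine ⟨max C₁ C₂, min θ γ, le_max_of_le_left hC₁, lt_min hθ hγ, fun i => ?_⟩
  refine queue_drift_le (V := fun i => (i : ℝ) ^ k) (fun i => by simp [hk.neg_pow])
    (fun n => ?_) (fun n => ?_) i
  · have h3 := mul_le_mul_of_nonneg_right (min_le_left θ γ)
      (pow_nonneg n.cast_nonneg k : (0 : ℝ) ≤ n ^ k)
    push_cast
    linarith [h₁ n n.cast_nonneg, le_max_left C₁ C₂]
  · have h3 := mul_le_mul_of_nonneg_right (min_le_right θ γ)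
      (pow_nonneg n.cast_nonneg k : (0 : ℝ) ≤ n ^ k)
    push_cast
    linarith [h₂ n n.cast_nonneg, le_max_right C₁ C₂]

variable {P : ℝ≥0 → ℤ → ℤ → ℝ}

theorem exists_moment_bound (hα : 0 < α) (hβ : 0 < β) (hθ : 0 < θ) (hγ : 0 < γ)
    (hP : IsTransitionFunction P)
    (hQ : HasTransitionRates P (birthDeathRates (queueBirthRate α γ) (queueDeathRate β θ)))
    {k : ℕ} (hk0 : k ≠ 0) (hk : Even k)
    (hdrift : ∀ {α β θ : ℝ}, 0 < α → 0 < β → 0 < θ → ∃ C, 0 ≤ C ∧ ∀ x : ℝ, 0 ≤ x →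
      α * ((x + 1) ^ k - x ^ k) + (β + x * θ) * ((x - 1) ^ k - x ^ k) ≤ C - θ * x ^ k) :
    ∃ B, ∀ (t : ℝ≥0) (i : ℤ) (F : Finset ℤ),
      ∑ j ∈ F, P t i j * (j : ℝ) ^ k ≤ (i : ℝ) ^ k + B := by
  obtain ⟨C, c, hC, hc, h⟩ := exists_queue_drift (γ := γ) hk hdrift hα hβ hθ hγ
  exact ⟨C / c, fun t i F => sum_transition_mul_le_of_drift hP hQ
    (fun i => (queueBirthRate_pos hα hγ i).le) (fun i => (queueDeathRate_pos hβ hθ i).le)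
    (tendsto_intCast_pow_cofinite hk0 hk) (fun i => hk.pow_nonneg _) hC hc h F t i⟩

/-- Two copies of the queue started at different states forget their starting point at the smaller
of the two abandonment rates, which is the killing rate of the difference process. -/
theorem abs_queue_transition_sub_le (hα : 0 < α) (hβ : 0 < β) (hθ : 0 < θ) (hγ : 0 < γ)
    (hP : IsTransitionFunction P)
    (hQ : HasTransitionRates P (birthDeathRates (queueBirthRate α γ) (queueDeathRate β θ)))
    (t : ℝ≥0) (i k j : ℤ) :
    |P t i j - P t k j| ≤ Real.exp (-min θ γ * t) * |(i : ℝ) - k| := by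
  have hmin := lt_min hθ hγ
  have hcases (i : ℤ) : (∃ n : ℕ, i = n) ∨ ∃ n : ℕ, i = -((n + 1 : ℕ) : ℤ) := by
    rcases lt_or_ge i 0 with h | h
    · exact Or.inr ⟨(-i - 1).toNat, by lia⟩
    · exact Or.inl ⟨i.toNat, by lia⟩
  refine abs_sub_le_of_abs_succ_sub_le (f := fun i => P t i j) (fun i => ?_) i k
  refine abs_transition_succ_sub_le hP hQ (fun i => (queueBirthRate_pos hα hγ i).le)
    (fun i => (queueDeathRate_pos hβ hθ i).le) (V := fun i : ℤ => (i : ℝ) ^ 2 + 1)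
    (K := 2 * α + 2 * β + 1) (tendsto_atTop_add_const_right _ _
      (tendsto_intCast_pow_cofinite two_ne_zero even_two)) (fun i => by positivity)
    (by positivity) hmin.le (fun i => ?_) (fun i => ?_) t i j
  · rcases hcases i with ⟨n, rfl⟩ | ⟨n, rfl⟩
    · have h := queueBirthRate_natCast α γ (n + 1)
      have h' := queueDeathRate_natCast β θ (n + 1)
      push_cast at h h'
      rw [h, h', queueBirthRate_natCast, queueDeathRate_natCast]
      linarith [min_le_left θ γ]
    · rw [show -((n + 1 : ℕ) : ℤ) + 1 = -(n : ℤ) by push_cast; ring]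
      simp only [queueBirthRate_neg_natCast, queueDeathRate_neg_natCast]
      push_cast
      linarith [min_le_right θ γ]
  · rcases hcases i with ⟨n, rfl⟩ | ⟨n, rfl⟩
    · have h := queueBirthRate_natCast α γ (n + 1)
      have h' := queueDeathRate_natCast β θ (n + 1)
      push_cast at h h'
      rw [h, h', queueBirthRate_natCast, queueDeathRate_natCast]
      push_cast
      have hn : (0 : ℝ) ≤ n := n.cast_nonneg
      have hn2 : (n : ℝ) ≤ n ^ 2 := by exact_mod_cast Nat.le_self_pow two_ne_zero n
      nlinarith [mul_le_mul_of_nonneg_left hn2 hα.le, mul_le_mul_of_nonneg_left hn2 hβ.le,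
        mul_le_mul_of_nonneg_left hn2 hθ.le, mul_nonneg hα.le hn, mul_nonneg hβ.le hn,
        mul_nonneg hθ.le hn, mul_nonneg hα.le (sq_nonneg (n : ℝ))]
    · rw [show -((n + 1 : ℕ) : ℤ) + 1 = -(n : ℤ) by push_cast; ring]
      simp only [queueBirthRate_neg_natCast, queueDeathRate_neg_natCast]
      push_cast
      have hn : (0 : ℝ) ≤ n := n.cast_nonneg
      have hn2 : (n : ℝ) ≤ n ^ 2 := by exact_mod_cast Nat.le_self_pow two_ne_zero n
      nlinarith [mul_le_mul_of_nonneg_left hn2 hα.le, mul_le_mul_of_nonneg_left hn2 hβ.le,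
        mul_le_mul_of_nonneg_left hn2 hγ.le, mul_nonneg hα.le hn, mul_nonneg hβ.le hn,
        mul_nonneg hγ.le hn, mul_nonneg hα.le (sq_nonneg (n : ℝ)),
        mul_nonneg hγ.le (sq_nonneg (n : ℝ))]

end Queue

/-! ### The incomplete Gamma function as a series -/

section IncompleteGamma

theorem intervalIntegrable_rpow_mul_exp {t : ℝ} (ht : 0 < t) (y : ℝ) :
    IntervalIntegrable (fun x => x ^ (t - 1) * Real.exp (-x)) volume 0 y :=
  (intervalIntegral.intervalIntegrable_rpow' (by linarith)).mul_continuousOn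
    (by fun_prop)

theorem lowerIncompleteGamma_add_one {t y : ℝ} (ht : 0 < t) (hy : 0 ≤ y) :
    lowerIncompleteGamma (t + 1) y
      = t * lowerIncompleteGamma t y - y ^ t * Real.exp (-y) := by
  have h1 := intervalIntegrable_rpow_mul_exp ht y
  have h2 := intervalIntegrable_rpow_mul_exp (by linarith : 0 < t + 1) y
  have h3 := intervalIntegral.integral_eq_sub_of_hasDerivAt_of_le (a := 0) (b := y) hy
    (f := fun x => x ^ t * Real.exp (-x))
    (f' := fun x => t * (x ^ (t - 1) * Real.exp (-x)) - x ^ (t + 1 - 1) * Real.exp (-x))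
    (((Real.continuous_rpow_const ht.le).mul (by fun_prop)).continuousOn)
    (fun x hx => by
      refine ((Real.hasDerivAt_rpow_const (p := t) (Or.inl hx.1.ne')).mul
        (hasDerivAt_neg x).exp).congr_deriv ?_
      simp only [add_sub_cancel_right]
      ring)
    ((h1.const_mul t).sub h2)
  rw [intervalIntegral.integral_sub (h1.const_mul t) h2,
    intervalIntegral.integral_const_mul, Real.zero_rpow ht.ne'] at h3
  simp only [lowerIncompleteGamma]
  linarith

theorem lowerIncompleteGamma_nonneg (t : ℝ) {y : ℝ} (hy : 0 ≤ y) :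
    0 ≤ lowerIncompleteGamma t y :=
  intervalIntegral.integral_nonneg hy fun _ hx =>
    mul_nonneg (Real.rpow_nonneg hx.1 _) (Real.exp_pos _).le

theorem lowerIncompleteGamma_le {t y : ℝ} (ht : 0 < t) (hy : 0 ≤ y) :
    lowerIncompleteGamma t y ≤ y ^ t / t := by
  have h1 : lowerIncompleteGamma t y ≤ ∫ x in (0 : ℝ)..y, x ^ (t - 1) := by
    refine intervalIntegral.integral_mono_on hy (intervalIntegrable_rpow_mul_exp ht y)
      (intervalIntegral.intervalIntegrable_rpow' (by linarith)) fun x hx => ?_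
    exact mul_le_of_le_one_right (Real.rpow_nonneg hx.1 _)
      (Real.exp_le_one_iff.2 (by linarith [hx.1]))
  rwa [integral_rpow (Or.inl (by linarith)), sub_add_cancel, Real.zero_rpow ht.ne',
    sub_zero] at h1

/-- The normalized incomplete Gamma function `t * exp y * y ^ (-t) * Γ(t, y)`, which equals
`∑ yⁿ / ((t + 1) ⋯ (t + n))`. -/
noncomputable def normalizedGamma (t y : ℝ) : ℝ :=
  t * Real.exp y * y ^ (-t) * lowerIncompleteGamma t y

theorem normalizedGamma_eq {t y : ℝ} (ht : 0 < t) (hy : 0 < y) :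
    normalizedGamma t y = 1 + y / (t + 1) * normalizedGamma (t + 1) y := by
  have h1 := Real.rpow_pos_of_pos hy t
  rw [normalizedGamma, normalizedGamma, lowerIncompleteGamma_add_one ht hy.le, Real.exp_neg,
    Real.rpow_neg hy.le, Real.rpow_neg hy.le, Real.rpow_add hy, Real.rpow_one]
  have := Real.exp_pos y
  field_simp
  ring

theorem normalizedGamma_nonneg {t y : ℝ} (ht : 0 < t) (hy : 0 < y) :
    0 ≤ normalizedGamma t y := by
  have := lowerIncompleteGamma_nonneg t hy.le
  unfold normalizedGamma
  positivity

theorem normalizedGamma_le {t y : ℝ} (ht : 0 < t) (hy : 0 < y) :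
    normalizedGamma t y ≤ Real.exp y := by
  have h1 := Real.rpow_pos_of_pos hy t
  calc normalizedGamma t y ≤ t * Real.exp y * y ^ (-t) * (y ^ t / t) :=
        mul_le_mul_of_nonneg_left (lowerIncompleteGamma_le ht hy.le) (by positivity)
    _ = Real.exp y := by
        rw [Real.rpow_neg hy.le]
        field_simp

end IncompleteGamma

/-! ### Reversible weights -/

/-- Weights, relative to state `0`, of the states `n ≥ 0` of a birth and death chain with birth
rate `α` and death rate `β + n θ`: `∏_{1 ≤ k ≤ n} α / (β + k θ)`. -/
noncomputable def halfWeight (α β θ : ℝ) (n : ℕ) : ℝ :=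
  ∏ k ∈ Finset.range n, α / (β + (k + 1) * θ)

section HalfWeight

variable {α β θ : ℝ}

theorem halfWeight_pos (hα : 0 < α) (hβ : 0 < β) (hθ : 0 < θ) (n : ℕ) :
    0 < halfWeight α β θ n :=
  Finset.prod_pos fun k _ => by positivity

theorem halfWeight_succ (hβ : 0 < β) (hθ : 0 < θ) (n : ℕ) :
    (β + (n + 1) * θ) * halfWeight α β θ (n + 1) = α * halfWeight α β θ n := by
  have : β + (n + 1) * θ ≠ 0 := by positivity
  rw [halfWeight, Finset.prod_range_succ, ← halfWeight]
  field_simp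

theorem summable_halfWeight (hα : 0 < α) (hβ : 0 < β) (hθ : 0 < θ) :
    Summable (halfWeight α β θ) := by
  have h0 := halfWeight_pos hα hβ hθ
  refine summable_of_ratio_test_tendsto_lt_one (l := 0) zero_lt_one
    (Eventually.of_forall fun n => (h0 n).ne') ?_
  have h1 : Tendsto (fun n : ℕ => β + ((n : ℝ) + 1) * θ) atTop atTop :=
    tendsto_atTop_add_const_left _ _
      ((tendsto_atTop_add_const_right _ _ tendsto_natCast_atTop_atTop).atTop_mul_const hθ)
  refine (h1.const_div_atTop α).congr fun n => ?_
  rw [Real.norm_of_nonneg (h0 _).le, Real.norm_of_nonneg (h0 _).le,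
    div_eq_div_iff (by positivity) (h0 n).ne', ← halfWeight_succ hβ hθ n]
  ring

/-- Iterated recursion for the normalized incomplete Gamma function; the last summand tends to
zero because `normalizedGamma` is at most `exp (α / θ)`. -/
theorem normalizedGamma_eq_sum (hα : 0 < α) (hβ : 0 < β) (hθ : 0 < θ) (n : ℕ) :
    normalizedGamma (β / θ) (α / θ) = ∑ k ∈ Finset.range n, halfWeight α β θ k +
      halfWeight α β θ n * normalizedGamma (β / θ + n) (α / θ) := by
  induction n with
  | zero => simp [halfWeight]
  | succ n ih =>
    have h1 : halfWeight α β θ (n + 1)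
        = halfWeight α β θ n * ((α / θ) / (β / θ + n + 1)) := by
      rw [halfWeight, Finset.prod_range_succ, ← halfWeight]
      congr 1
      field_simp
      ring
    rw [ih, normalizedGamma_eq (by positivity) (by positivity), Finset.sum_range_succ, h1]
    push_cast
    rw [add_assoc (β / θ)]
    ring

theorem hasSum_halfWeight (hα : 0 < α) (hβ : 0 < β) (hθ : 0 < θ) :
    HasSum (halfWeight α β θ) (normalizedGamma (β / θ) (α / θ)) := by
  have hs := summable_halfWeight hα hβ hθ
  have h1 : Tendsto (fun n : ℕ => halfWeight α β θ n * normalizedGamma (β / θ + n) (α / θ)) atTop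
      (𝓝 0) := by
    refine squeeze_zero (fun n => ?_) (fun n => ?_)
      (by simpa using hs.tendsto_atTop_zero.mul_const (Real.exp (α / θ)))
    · exact mul_nonneg (halfWeight_pos hα hβ hθ n).le
        (normalizedGamma_nonneg (by positivity) (by positivity))
    · exact mul_le_mul_of_nonneg_left (normalizedGamma_le (by positivity) (by positivity))
        (halfWeight_pos hα hβ hθ n).le
  have h2 : Tendsto (fun n : ℕ => ∑ k ∈ Finset.range n, halfWeight α β θ k) atTop
      (𝓝 (normalizedGamma (β / θ) (α / θ))) := by
    have := h1.const_sub (normalizedGamma (β / θ) (α / θ))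
    rw [sub_zero] at this
    refine this.congr fun n => ?_
    linarith [normalizedGamma_eq_sum hα hβ hθ n]
  have h3 := hs.hasSum
  rwa [tendsto_nhds_unique h3.tendsto_sum_nat h2] at h3

/-- Sum the balance relation `(β + n θ) wₙ = α wₙ₋₁` over `n ≥ 1`. -/
theorem hasSum_nat_mul_halfWeight (hβ : 0 < β) (hθ : 0 < θ) {p : ℝ}
    (h : HasSum (halfWeight α β θ) (p + 1)) :
    HasSum (fun n : ℕ => (n : ℝ) * halfWeight α β θ n) ((α - β) / θ * p + α / θ) := by
  have h1 := (hasSum_nat_add_iff' 1).2 h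
  have h2 := ((h.mul_left α).sub (h1.mul_left β)).mul_left θ⁻¹
  have hval : (α - β) / θ * p + α / θ - ∑ i ∈ Finset.range 1, (i : ℝ) * halfWeight α β θ i
      = θ⁻¹ * (α * (p + 1) - β * (p + 1 - ∑ i ∈ Finset.range 1, halfWeight α β θ i)) := by
    simp [halfWeight]
    field_simp
    ring
  rw [← hasSum_nat_add_iff' 1, hval]
  refine h2.congr_fun fun n => ?_
  rw [← halfWeight_succ hβ hθ]
  push_cast
  field_simp
  ring

/-- Sum `n` times the balance relation over `n ≥ 1`. -/
theorem hasSum_nat_sq_mul_halfWeight (hβ : 0 < β) (hθ : 0 < θ) {p m : ℝ}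
    (h : HasSum (halfWeight α β θ) (p + 1))
    (hm : HasSum (fun n : ℕ => (n : ℝ) * halfWeight α β θ n) m) :
    HasSum (fun n : ℕ => (n : ℝ) ^ 2 * halfWeight α β θ n)
      ((α - β) / θ * m + α / θ * (p + 1)) := by
  have h1 := (hasSum_nat_add_iff' 1).2 hm
  have h2 := (((hm.add h).mul_left α).sub (h1.mul_left β)).mul_left θ⁻¹
  have hval : (α - β) / θ * m + α / θ * (p + 1) -
        ∑ i ∈ Finset.range 1, (i : ℝ) ^ 2 * halfWeight α β θ i
      = θ⁻¹ * (α * (m + (p + 1)) -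
        β * (m - ∑ i ∈ Finset.range 1, (i : ℝ) * halfWeight α β θ i)) := by
    simp
    field_simp
    ring
  rw [← hasSum_nat_add_iff' 1, hval]
  refine h2.congr_fun fun n => ?_
  rw [← add_one_mul (n : ℝ), mul_left_comm α, ← halfWeight_succ hβ hθ]
  push_cast
  field_simp
  ring

end HalfWeight

/-- Reversible weights of the double-ended queue, normalized to be `1` at the state `0`. -/
noncomputable def queueWeight (α β θ γ : ℝ) (i : ℤ) : ℝ :=
  if 0 ≤ i then halfWeight α β θ i.toNat else halfWeight β α γ (-i).toNat

section QueueWeight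

variable {α β θ γ : ℝ}

theorem queueWeight_natCast (α β θ γ : ℝ) (n : ℕ) :
    queueWeight α β θ γ n = halfWeight α β θ n := by
  simp [queueWeight]

theorem queueWeight_neg_natCast (α β θ γ : ℝ) (n : ℕ) :
    queueWeight α β θ γ (-n) = halfWeight β α γ n := by
  rcases n with _ | n
  · simp [queueWeight, halfWeight]
  · have : ¬ (0 : ℤ) ≤ -((n + 1 : ℕ) : ℤ) := by lia
    rw [queueWeight, if_neg this]
    simp

theorem queueWeight_pos (hα : 0 < α) (hβ : 0 < β) (hθ : 0 < θ) (hγ : 0 < γ) (i : ℤ) :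
    0 < queueWeight α β θ γ i := by
  unfold queueWeight
  split_ifs
  · exact halfWeight_pos hα hβ hθ _
  · exact halfWeight_pos hβ hα hγ _

theorem queueWeight_balance (hα : 0 < α) (hβ : 0 < β) (hθ : 0 < θ) (hγ : 0 < γ) (i : ℤ) :
    queueWeight α β θ γ i * queueBirthRate α γ i
      = queueWeight α β θ γ (i + 1) * queueDeathRate β θ (i + 1) := by
  have hcases : (∃ n : ℕ, i = n) ∨ ∃ n : ℕ, i = -((n + 1 : ℕ) : ℤ) := by
    rcases lt_or_ge i 0 with h | h
    · exact Or.inr ⟨(-i - 1).toNat, by lia⟩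
    · exact Or.inl ⟨i.toNat, by lia⟩
  rcases hcases with ⟨n, rfl⟩ | ⟨n, rfl⟩
  · rw [show (n : ℤ) + 1 = ((n + 1 : ℕ) : ℤ) by push_cast; ring]
    simp only [queueWeight_natCast, queueBirthRate_natCast, queueDeathRate_natCast]
    push_cast
    linarith [halfWeight_succ (α := α) hβ hθ n]
  · rw [show -((n + 1 : ℕ) : ℤ) + 1 = -(n : ℤ) by push_cast; ring]
    simp only [queueWeight_neg_natCast, queueBirthRate_neg_natCast, queueDeathRate_neg_natCast]
    push_cast
    linarith [halfWeight_succ (α := β) hα hγ n]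

/-- The state `0` belongs to both half-lines, so its contribution `g 0` is subtracted once. -/
theorem hasSum_mul_queueWeight {g : ℤ → ℝ} {A B : ℝ}
    (hA : HasSum (fun n : ℕ => g n * halfWeight α β θ n) A)
    (hB : HasSum (fun n : ℕ => g (-n) * halfWeight β α γ n) B) :
    HasSum (fun i => g i * queueWeight α β θ γ i) (A + B - g 0) := by
  have h1 := (hasSum_nat_add_iff' 1).2 hB
  have h2 := HasSum.of_nat_of_neg_add_one (f := fun i => g i * queueWeight α β θ γ i)
    (m := A) (m' := B - g 0) (by simpa only [queueWeight_natCast] using hA) (by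
      have hval : B - g 0 = B - ∑ i ∈ Finset.range 1, g (-i) * halfWeight β α γ i := by
        simp [halfWeight]
      rw [hval]
      refine h1.congr_fun fun n => ?_
      rw [← queueWeight_neg_natCast α β θ γ]
      push_cast
      rfl)
  rwa [← add_sub_assoc] at h2

end QueueWeight

/-! ### Stationarity and convergence -/

section Stationary

variable {P : ℝ≥0 → ℤ → ℤ → ℝ} {b d π : ℤ → ℝ}

/-- Detailed balance implies stationarity: the derivative of `∑ i, π i * P t i j` telescopes, once
the probability flow `π i * b i` is summable. -/
theorem hasSum_stationary_of_balance (hP : IsTransitionFunction P)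
    (hQ : HasTransitionRates P (birthDeathRates b d)) (hb : ∀ i, 0 ≤ b i)
    (hπ : ∀ i, 0 ≤ π i) (hsum : Summable π) (hflow : Summable fun i => π i * b i)
    (hbal : ∀ i, π i * b i = π (i + 1) * d (i + 1)) (t : ℝ≥0) (j : ℤ) :
    HasSum (fun i => π i * P t i j) (π j) := by
  have hle (t : ℝ≥0) (i : ℤ) : ‖π i * P t i j‖ ≤ π i := by
    rw [Real.norm_of_nonneg (mul_nonneg (hπ i) (hP.nonneg t i j))]
    exact mul_le_of_le_one_right (hπ i) (hP.le_one t i j)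
  have hsummable (t : ℝ≥0) : Summable fun i => π i * P t i j :=
    Summable.of_norm_bounded hsum (hle t)
  have hbal' (i : ℤ) : π i * d i = π (i - 1) * b (i - 1) := by
    have := hbal (i - 1)
    rw [sub_add_cancel] at this
    exact this.symm
  have hflow' : Summable fun i => π i * d i := by
    have := (Equiv.subRight (1 : ℤ)).summable_iff.2 hflow
    exact this.congr fun i => (hbal' i).symm
  set v : ℝ → ℝ := fun t => ∑' i, π i * P t.toNNReal i j with hv
  have hvc : Continuous v := by
    refine continuous_tsum (u := π) (fun i => ?_) hsum fun i t => hle _ i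
    exact (continuous_transition hP hQ i j).const_mul (π i)
  have hinc (t : ℝ≥0) (i k : ℤ) : |P t i j - P t k j| ≤ 1 := by
    rw [abs_le]
    constructor <;> linarith [hP.nonneg t i j, hP.le_one t i j, hP.nonneg t k j, hP.le_one t k j]
  have hvd : ∀ t, 0 < t → HasDerivAt v 0 t := by
    intro t ht
    have h1 := hasDerivAt_tsum_of_isPreconnected (t := Set.Ioi (0 : ℝ)) (y₀ := 1) (y := t)
      (g := fun i t => π i * P t.toNNReal i j) (u := fun i => π i * b i + π i * d i)
      (g' := fun i t => π i * (b i * (P t.toNNReal (i + 1) j - P t.toNNReal i j) +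
        d i * (P t.toNNReal (i - 1) j - P t.toNNReal i j)))
      (hflow.add hflow') isOpen_Ioi isPreconnected_Ioi
      (fun i y hy => (hasDerivAt_transition hP hQ i j hy).const_mul (π i))
      (fun i y hy => by
        have hd' : 0 ≤ π i * d i := by
          rw [hbal']
          exact mul_nonneg (hπ _) (hb _)
        rw [mul_add, ← mul_assoc, ← mul_assoc]
        refine (norm_add_le _ _).trans (add_le_add ?_ ?_) <;> rw [Real.norm_eq_abs, abs_mul]
        · rw [abs_of_nonneg (mul_nonneg (hπ i) (hb i))]
          exact mul_le_of_le_one_right (mul_nonneg (hπ i) (hb i)) (hinc _ _ _)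
        · rw [abs_of_nonneg hd']
          exact mul_le_of_le_one_right hd' (hinc _ _ _))
      (Set.mem_Ioi.2 one_pos) (hsummable _) (Set.mem_Ioi.2 ht)
    refine h1.congr_deriv (HasSum.tsum_eq ?_)
    set c : ℤ → ℝ := fun i => π i * b i * (P t.toNNReal (i + 1) j - P t.toNNReal i j) with hc
    have hcs : Summable c := by
      refine Summable.of_norm_bounded hflow fun i => ?_
      rw [Real.norm_eq_abs, abs_mul, abs_of_nonneg (mul_nonneg (hπ i) (hb i))]
      exact mul_le_of_le_one_right (mul_nonneg (hπ i) (hb i)) (hinc _ _ _)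
    have h2 := hcs.hasSum.sub ((Equiv.subRight (1 : ℤ)).hasSum_iff.2 hcs.hasSum)
    rw [sub_self] at h2
    refine h2.congr_fun fun i => ?_
    simp only [hc, Function.comp, Equiv.subRight_apply, sub_add_cancel]
    rw [← hbal']
    ring
  have hconst : ∀ t, 0 ≤ t → v t = v 0 := by
    intro t ht
    have h1 := intervalIntegral.integral_eq_sub_of_hasDerivAt_of_le ht hvc.continuousOn
      (fun x hx => hvd x hx.1) intervalIntegrable_const
    rw [intervalIntegral.integral_zero] at h1
    linarith
  have h0 : v 0 = π j := by
    simp [hv, hP.zero]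
  have := (hsummable t).hasSum
  have h3 := hconst t t.2
  rw [h0] at h3
  simp only [hv, Real.toNNReal_coe] at h3
  rwa [h3] at this

/-- Convergence to a stationary distribution with finite first moment, for a chain that forgets its
starting point in the Wasserstein sense. -/
theorem tendsto_transition_of_contraction
    (hπ : IsStationaryDistribution P π) (hfirst : Summable fun i : ℤ => |(i : ℝ)| * π i) {c : ℝ}
    (hc : 0 < c)
    (hcon : ∀ (t : ℝ≥0) i k j, |P t i j - P t k j| ≤ Real.exp (-c * t) * |(i : ℝ) - k|)
    (i j : ℤ) : Tendsto (fun t => P t i j) atTop (𝓝 (π j)) := by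
  have h0 (k : ℤ) : π k * |(i : ℝ) - k| ≤ |(i : ℝ)| * π k + |(k : ℝ)| * π k := by
    have := mul_le_mul_of_nonneg_left (abs_sub (i : ℝ) k) (hπ.nonneg k)
    linarith
  have hs : Summable fun k : ℤ => π k * |(i : ℝ) - k| :=
    Summable.of_nonneg_of_le (fun k => mul_nonneg (hπ.nonneg k) (abs_nonneg _)) h0
      ((hπ.hasSum_one.summable.mul_left _).add hfirst)
  have hbound (t : ℝ≥0) : |P t i j - π j| ≤ Real.exp (-c * t) * ∑' k : ℤ, π k * |(i : ℝ) - k| := by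
    have h1 : HasSum (fun k => π k * (P t i j - P t k j)) (P t i j - π j) := by
      have := (hπ.hasSum_one.mul_right (P t i j)).sub (hπ.stationary t j)
      simpa [mul_sub] using this
    have h2 := hs.hasSum.mul_left (Real.exp (-c * t))
    have h3 (k : ℤ) : |π k * (P t i j - P t k j)|
        ≤ Real.exp (-c * t) * (π k * |(i : ℝ) - k|) := by
      rw [abs_mul, abs_of_nonneg (hπ.nonneg k)]
      have := mul_le_mul_of_nonneg_left (hcon t i k j) (hπ.nonneg k)
      linarith
    rw [abs_le]
    exact ⟨hasSum_le (fun k => (abs_le.1 (h3 k)).1) h2.neg h1,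
      hasSum_le (fun k => (abs_le.1 (h3 k)).2) h1 h2⟩
  have hexp : Tendsto (fun t : ℝ≥0 => Real.exp (-c * t) * ∑' k : ℤ, π k * |(i : ℝ) - k|) atTop
      (𝓝 0) := by
    have h1 : Tendsto (fun t : ℝ≥0 => -c * (t : ℝ)) atTop atBot :=
      (NNReal.tendsto_coe_atTop.2 tendsto_id).const_mul_atTop_of_neg (by linarith)
    simpa using (Real.tendsto_exp_atBot.comp h1).mul_const (∑' k : ℤ, π k * |(i : ℝ) - k|)
  rw [tendsto_iff_dist_tendsto_zero]
  exact squeeze_zero (fun _ => dist_nonneg) hbound hexp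

theorem IsStationaryDistribution.eq_of_isLimitingDistribution {S : Type*} [DecidableEq S]
    {P : ℝ≥0 → S → S → ℝ} {π π' : S → ℝ} (hP : IsTransitionFunction P)
    (h : IsLimitingDistribution P π) (h' : IsStationaryDistribution P π') : π' = π := by
  funext j
  have h1 : Tendsto (fun t => ∑' i, π' i * P t i j) atTop (𝓝 (∑' i, π' i * π j)) := by
    refine tendsto_tsum_of_dominated_convergence h'.hasSum_one.summable
      (fun i => (h.tendsto i j).const_mul _) (Eventually.of_forall fun t i => ?_)
    rw [Real.norm_of_nonneg (mul_nonneg (h'.nonneg i) (hP.nonneg t i j))]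
    exact mul_le_of_le_one_right (h'.nonneg i) (hP.le_one t i j)
  simp only [(h'.stationary _ j).tsum_eq, tsum_mul_right, h'.hasSum_one.tsum_eq, one_mul] at h1
  exact tendsto_nhds_unique tendsto_const_nhds h1

end Stationary

/-! ### Expectations along the chain -/

section Law

variable {S Ω : Type*} [MeasurableSpace S] [MeasurableSpace Ω] [Countable S]
  [MeasurableSingletonClass S]

theorem integrable_comp_iff_summable {μ : Measure Ω} [IsFiniteMeasure μ] {Y : Ω → S}
    (hY : Measurable Y) (g : S → ℝ) :
    Integrable (fun ω => g (Y ω)) μ ↔ Summable fun j => μ.real {ω | Y ω = j} * |g j| := by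
  have hmap (j : S) : (μ.map Y {j}).toReal = μ.real {ω | Y ω = j} := by
    rw [Measure.map_apply hY (measurableSet_singleton j)]
    rfl
  have h1 : Integrable (fun ω => g (Y ω)) μ ↔ Integrable g (μ.map Y) :=
    (integrable_map_measure (measurable_of_countable g).aestronglyMeasurable hY.aemeasurable).symm
  rw [h1]
  constructor
  · intro h
    rw [← Measure.sum_smul_dirac (μ.map Y)] at h
    have := h.summable_of_dirac
    simpa only [hmap, Real.norm_eq_abs] using this
  · intro h
    rw [← Measure.sum_smul_dirac (μ.map Y)]
    refine integrable_sum_dirac (fun j => measure_ne_top _ _) ?_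
    simpa only [hmap, Real.norm_eq_abs] using h

theorem hasSum_integral_comp {μ : Measure Ω} [IsFiniteMeasure μ] {Y : Ω → S}
    (hY : Measurable Y) {g : S → ℝ} (hg : Integrable (fun ω => g (Y ω)) μ) :
    HasSum (fun j => μ.real {ω | Y ω = j} * g j) (∫ ω, g (Y ω) ∂μ) := by
  have hmap (j : S) : (μ.map Y).real {j} = μ.real {ω | Y ω = j} := by
    rw [map_measureReal_apply hY (measurableSet_singleton j)]
    rfl
  have h1 : Integrable g (μ.map Y) :=
    (integrable_map_measure (measurable_of_countable g).aestronglyMeasurable hY.aemeasurable).2 hg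
  have h2 := (integrable_comp_iff_summable hY g).1 hg
  have h3 : Summable fun j => μ.real {ω | Y ω = j} * g j :=
    Summable.of_norm (h2.congr fun j => by
      rw [Real.norm_eq_abs, abs_mul, abs_of_nonneg measureReal_nonneg])
  rw [← integral_map hY.aemeasurable (measurable_of_countable g).aestronglyMeasurable,
    integral_countable h1]
  simpa only [hmap, smul_eq_mul] using h3.hasSum

variable {P : ℝ≥0 → S → S → ℝ} {X : ℝ≥0 → Ω → S} {ℙ : Measure Ω} [IsFiniteMeasure ℙ]

theorem IsMarkovChain.hasSum_law (hX : IsMarkovChain P X ℙ) (t : ℝ≥0) (j : S) :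
    HasSum (fun k => ℙ.real {ω | X 0 ω = k} * P t k j) (ℙ.real {ω | X t ω = j}) := by
  have hA : MeasurableSet {ω | X t ω = j} := hX.measurable t (measurableSet_singleton j)
  have h1 := hasSum_integral_comp (μ := ℙ.restrict {ω | X t ω = j}) (hX.measurable 0)
    (g := fun _ => 1) (integrable_const _)
  have h2 : ∫ _, (1 : ℝ) ∂(ℙ.restrict {ω | X t ω = j}) = ℙ.real {ω | X t ω = j} := by
    simp
  rw [h2] at h1
  refine h1.congr_fun fun k => ?_
  have hk : MeasurableSet {ω | X 0 ω = k} := hX.measurable 0 (measurableSet_singleton k)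
  rw [mul_one, measureReal_restrict_apply hk]
  have h3 := hX.finite_dimensional 1 (fun n => if n = 0 then 0 else t)
    (by
      intro m n hmn
      dsimp only
      split_ifs with hm hn hn
      · exact le_rfl
      · exact zero_le
      · exact absurd (Nat.le_zero.1 (hn ▸ hmn)) hm
      · exact le_rfl)
    (fun n => if n = 0 then k else j)
  simp only [Finset.range_one, Finset.prod_singleton, if_true, zero_add, one_ne_zero, if_false,
    tsub_zero] at h3
  rw [← h3]
  congr 1
  ext ω
  simp only [Set.mem_inter_iff, Set.mem_ofPred_eq]
  constructor
  · intro h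
    exact ⟨by simpa using h 0 zero_le, by simpa using h 1 le_rfl⟩
  · rintro ⟨h4, h5⟩ n hn
    interval_cases n <;> simpa

end Law

section Moments

variable {Ω : Type*} [MeasurableSpace Ω] {ℙ : Measure Ω} [IsProbabilityMeasure ℙ]
  {P : ℝ≥0 → ℤ → ℤ → ℝ} {X : ℝ≥0 → Ω → ℤ} {π : ℤ → ℝ}

/-- Functions dominated by `j ^ 2` are uniformly integrable along the chain started at `k`, because
fourth moments stay bounded: `P t k j * j ^ 2 ≤ M / j ^ 2`. -/
theorem tendsto_tsum_transition_mul (hP : IsTransitionFunction P)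
    (hlim : IsLimitingDistribution P π) {k : ℤ} {M : ℝ}
    (hM : ∀ (t : ℝ≥0) (F : Finset ℤ), ∑ j ∈ F, P t k j * (j : ℝ) ^ 4 ≤ M)
    {g : ℤ → ℝ} (hg : ∀ j, |g j| ≤ (j : ℝ) ^ 2) :
    Tendsto (fun t => ∑' j, P t k j * g j) atTop (𝓝 (∑' j, π j * g j)) := by
  refine tendsto_tsum_of_dominated_convergence (bound := fun j : ℤ => M * (1 / (j : ℝ) ^ 2))
    ((Real.summable_one_div_int_pow.2 one_lt_two).mul_left M)
    (fun j => (hlim.tendsto k j).mul_const _) (Eventually.of_forall fun t j => ?_)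
  rw [Real.norm_eq_abs, abs_mul, abs_of_nonneg (hP.nonneg t k j)]
  refine (mul_le_mul_of_nonneg_left (hg j) (hP.nonneg t k j)).trans ?_
  rcases eq_or_ne j 0 with rfl | hj
  · simp
  · have h1 := hM t {j}
    rw [Finset.sum_singleton] at h1
    have h2 : (0 : ℝ) < (j : ℝ) ^ 2 := by positivity
    -- the fourth-moment bound restricted to the single state `j`
    rw [mul_one_div, le_div_iff₀ h2]
    linarith

theorem summable_transition_mul (hP : IsTransitionFunction P) {t : ℝ≥0} {k : ℤ} {M : ℝ}
    (hM : ∀ F : Finset ℤ, ∑ j ∈ F, P t k j * (j : ℝ) ^ 2 ≤ M) {g : ℤ → ℝ}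
    (hg : ∀ j, |g j| ≤ (j : ℝ) ^ 2) :
    (Summable fun j => P t k j * |g j|) ∧ ∑' j, P t k j * |g j| ≤ M := by
  have h0 (j : ℤ) : 0 ≤ P t k j * |g j| := mul_nonneg (hP.nonneg t k j) (abs_nonneg _)
  have h1 (F : Finset ℤ) : ∑ j ∈ F, P t k j * |g j| ≤ M :=
    (Finset.sum_le_sum fun j _ => mul_le_mul_of_nonneg_left (hg j) (hP.nonneg t k j)).trans (hM F)
  exact ⟨summable_of_sum_le h0 h1, Real.tsum_le_of_sum_le h0 h1⟩

theorem summable_initial_mul (hX : IsMarkovChain P X ℙ)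
    (hX0 : Integrable (fun ω => (X 0 ω : ℝ) ^ 2) ℙ) (B : ℝ) :
    Summable fun k : ℤ => ℙ.real {ω | X 0 ω = k} * ((k : ℝ) ^ 2 + B) := by
  have h1 := (integrable_comp_iff_summable (hX.measurable 0) (fun k : ℤ => (k : ℝ) ^ 2)).1 hX0
  have h2 := (hasSum_integral_comp (μ := ℙ) (hX.measurable 0)
    (g := fun _ => B) (integrable_const _)).summable
  refine (h1.add h2).congr fun k => ?_
  rw [abs_of_nonneg (sq_nonneg _)]
  ring

/-- Conditioning on the initial state, for functions dominated by `j ^ 2`. -/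
theorem integrable_and_hasSum_integral (hP : IsTransitionFunction P) (hX : IsMarkovChain P X ℙ)
    (hX0 : Integrable (fun ω => (X 0 ω : ℝ) ^ 2) ℙ) {B : ℝ}
    (hB : ∀ (t : ℝ≥0) (i : ℤ) (F : Finset ℤ),
      ∑ j ∈ F, P t i j * (j : ℝ) ^ 2 ≤ (i : ℝ) ^ 2 + B)
    {g : ℤ → ℝ} (hg : ∀ j, |g j| ≤ (j : ℝ) ^ 2) (t : ℝ≥0) :
    Integrable (fun ω => g (X t ω)) ℙ ∧
      HasSum (fun k => ℙ.real {ω | X 0 ω = k} * ∑' j, P t k j * g j) (∫ ω, g (X t ω) ∂ℙ) := by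
  have hg0 (k j : ℤ) : 0 ≤ P t k j * |g j| := mul_nonneg (hP.nonneg t k j) (abs_nonneg _)
  have hinit := summable_initial_mul hX hX0 B
  have habs : Summable fun p : ℤ × ℤ => ℙ.real {ω | X 0 ω = p.1} * (P t p.1 p.2 * |g p.2|) := by
    rw [summable_prod_of_nonneg fun p => mul_nonneg measureReal_nonneg (hg0 p.1 p.2)]
    dsimp only
    simp only [tsum_mul_left]
    constructor
    · intro k
      exact Summable.mul_left _ (summable_transition_mul hP (hB t k) hg).1
    · exact Summable.of_nonneg_of_le
        (fun k => mul_nonneg measureReal_nonneg (tsum_nonneg fun j => hg0 k j))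
        (fun k => mul_le_mul_of_nonneg_left (summable_transition_mul hP (hB t k) hg).2
          measureReal_nonneg) hinit
  have hint : Integrable (fun ω => g (X t ω)) ℙ := by
    rw [integrable_comp_iff_summable (hX.measurable t)]
    refine (habs.prod_symm.prod).congr fun j => ?_
    have := (hX.hasSum_law t j).mul_right |g j|
    rw [← this.tsum_eq]
    exact tsum_congr fun k => by simp [mul_assoc]
  refine ⟨hint, ?_⟩
  have hs : Summable fun p : ℤ × ℤ => ℙ.real {ω | X 0 ω = p.1} * (P t p.1 p.2 * g p.2) :=
    Summable.of_norm (habs.congr fun p => by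
      rw [Real.norm_eq_abs, abs_mul, abs_mul, abs_of_nonneg measureReal_nonneg,
        abs_of_nonneg (hP.nonneg t p.1 p.2)])
  have h1 : HasSum (fun j => ℙ.real {ω | X t ω = j} * g j)
      (∑' p : ℤ × ℤ, ℙ.real {ω | X 0 ω = p.1} * (P t p.1 p.2 * g p.2)) := by
    refine ((Equiv.prodComm ℤ ℤ).hasSum_iff.2 hs.hasSum).prod_fiberwise fun j => ?_
    refine ((hX.hasSum_law t j).mul_right (g j)).congr_fun fun k => ?_
    simp [mul_assoc]
  have h2 := hs.hasSum.prod_fiberwise (fun k => (hs.prod_factor k).hasSum)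
  rw [(hasSum_integral_comp (hX.measurable t) hint).unique h1]
  simpa only [tsum_mul_left] using h2

theorem tendsto_integral_of_le_sq (hP : IsTransitionFunction P) (hX : IsMarkovChain P X ℙ)
    (hX0 : Integrable (fun ω => (X 0 ω : ℝ) ^ 2) ℙ) (hlim : IsLimitingDistribution P π) {B B' : ℝ}
    (hB : ∀ (t : ℝ≥0) (i : ℤ) (F : Finset ℤ),
      ∑ j ∈ F, P t i j * (j : ℝ) ^ 2 ≤ (i : ℝ) ^ 2 + B)
    (hB' : ∀ (t : ℝ≥0) (i : ℤ) (F : Finset ℤ),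
      ∑ j ∈ F, P t i j * (j : ℝ) ^ 4 ≤ (i : ℝ) ^ 4 + B')
    {g : ℤ → ℝ} (hg : ∀ j, |g j| ≤ (j : ℝ) ^ 2) :
    Tendsto (fun t => ∫ ω, g (X t ω) ∂ℙ) atTop (𝓝 (∑' j, π j * g j)) := by
  have h1 : Tendsto (fun t => ∑' k, ℙ.real {ω | X 0 ω = k} * ∑' j, P t k j * g j) atTop
      (𝓝 (∑' k, ℙ.real {ω | X 0 ω = k} * ∑' j, π j * g j)) := by
    refine tendsto_tsum_of_dominated_convergence (summable_initial_mul hX hX0 B)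
      (fun k => (tendsto_tsum_transition_mul hP hlim (fun t F => hB' t k F) hg).const_mul _)
      (Eventually.of_forall fun t k => ?_)
    rw [Real.norm_eq_abs, abs_mul, abs_of_nonneg measureReal_nonneg]
    refine mul_le_mul_of_nonneg_left ?_ measureReal_nonneg
    have h2 := summable_transition_mul hP (hB t k) hg
    have h3 (j : ℤ) : ‖P t k j * g j‖ = P t k j * |g j| := by
      rw [Real.norm_eq_abs, abs_mul, abs_of_nonneg (hP.nonneg t k j)]
    have h4 := norm_tsum_le_tsum_norm (f := fun j => P t k j * g j)
      (h2.1.congr fun j => (h3 j).symm)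
    simp only [h3] at h4
    exact h4.trans h2.2
  have hone : ∑' k, ℙ.real {ω | X 0 ω = k} = 1 := by
    have := (hasSum_integral_comp (μ := ℙ) (hX.measurable 0)
      (g := fun _ => 1) (integrable_const _)).tsum_eq
    simpa using this
  rw [tsum_mul_right, hone, one_mul] at h1
  exact h1.congr fun t => (integrable_and_hasSum_integral hP hX hX0 hB hg t).2.tsum_eq

end Moments

/-! ### Limits for the double-ended queue -/

theorem lemma2 {Ω : Type*} [MeasurableSpace Ω] (ℙ : Measure Ω) [IsProbabilityMeasure ℙ]
    (α β θ γ : ℝ) (hα : 0 < α) (hβ : 0 < β) (hθ : 0 < θ) (hγ : 0 < γ)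
    (P : ℝ≥0 → ℤ → ℤ → ℝ) (hP : IsTransitionFunction P)
    (hQ : HasTransitionRates P
      (birthDeathRates (queueBirthRate α γ) (queueDeathRate β θ)))
    (X : ℝ≥0 → Ω → ℤ) (hX : IsMarkovChain P X ℙ)
    (hX0 : Integrable (fun ω => (X 0 ω : ℝ) ^ 2) ℙ)
    (p₁ p₂ : ℝ)
    (hp₁ : p₁ = β / θ * Real.exp (α / θ) * (α / θ) ^ (-β / θ) *
      lowerIncompleteGamma (β / θ) (α / θ) - 1)
    (hp₂ : p₂ = α / γ * Real.exp (β / γ) * (β / γ) ^ (-α / γ) *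
      lowerIncompleteGamma (α / γ) (β / γ) - 1) :
    ∃ π : ℤ → ℝ,
      IsStationaryDistribution P π ∧
      (∀ π' : ℤ → ℝ, IsStationaryDistribution P π' → π' = π) ∧
      IsLimitingDistribution P π ∧
      1 + p₁ + p₂ ≠ 0 ∧
      π 0 = (1 + p₁ + p₂)⁻¹ ∧
      (∀ t, Integrable (fun ω => (X t ω : ℝ) ^ 2) ℙ) ∧
      ∃ mPos mNeg : ℝ,
        mPos = ((α - β) / θ * p₁ + α / θ) * π 0 ∧
        mNeg = ((β - α) / γ * p₂ + β / γ) * π 0 ∧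
        Tendsto (posMoment X ℙ) atTop (𝓝 mPos) ∧
        Tendsto (negMoment X ℙ) atTop (𝓝 mNeg) ∧
        Tendsto (posSecondMoment X ℙ) atTop
          (𝓝 ((α - β) / θ * mPos + α / θ * (p₁ + 1) * π 0)) ∧
        Tendsto (negSecondMoment X ℙ) atTop
          (𝓝 ((β - α) / γ * mNeg + β / γ * (p₂ + 1) * π 0)) := by

  have hb := queueBirthRate_pos (α := α) (γ := γ) hα hγ
  have hr₁ : HasSum (halfWeight α β θ) (p₁ + 1) := by
    have := hasSum_halfWeight hα hβ hθ
    rwa [normalizedGamma, ← neg_div, ← sub_add_cancel (_ * _) 1, ← hp₁] at this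
  have hr₂ : HasSum (halfWeight β α γ) (p₂ + 1) := by
    have := hasSum_halfWeight hβ hα hγ
    rwa [normalizedGamma, ← neg_div, ← sub_add_cancel (_ * _) 1, ← hp₂] at this
  have hm₁ := hasSum_nat_mul_halfWeight hβ hθ hr₁
  have hm₂ := hasSum_nat_mul_halfWeight hα hγ hr₂
  have hs₁ := hasSum_nat_sq_mul_halfWeight hβ hθ hr₁ hm₁
  have hs₂ := hasSum_nat_sq_mul_halfWeight hα hγ hr₂ hm₂
  have hwpos := queueWeight_pos hα hβ hθ hγ
  have hw0 : queueWeight α β θ γ 0 = 1 := by simp [queueWeight, halfWeight]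
  have hw : HasSum (queueWeight α β θ γ) (1 + p₁ + p₂) := by
    have := hasSum_mul_queueWeight (g := fun _ => 1) (by simpa using hr₁) (by simpa using hr₂)
    rw [show p₁ + 1 + (p₂ + 1) - 1 = 1 + p₁ + p₂ by ring] at this
    simpa using this
  have hZ : 0 < 1 + p₁ + p₂ := by
    have := le_hasSum hw 0 fun i _ => (hwpos i).le
    linarith
  set π : ℤ → ℝ := fun i => queueWeight α β θ γ i * (1 + p₁ + p₂)⁻¹ with hπ
  have hπ0 : π 0 = (1 + p₁ + p₂)⁻¹ := by simp [hπ, hw0]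
  have hmoment {g : ℤ → ℝ} {A B : ℝ} (hA : HasSum (fun n : ℕ => g n * halfWeight α β θ n) A)
      (hB : HasSum (fun n : ℕ => g (-n) * halfWeight β α γ n) B) :
      HasSum (fun i => π i * g i) ((A + B - g 0) * π 0) := by
    rw [hπ0]
    refine ((hasSum_mul_queueWeight hA hB).mul_right _).congr_fun fun i => ?_
    simp only [hπ]
    ring
  have hnonneg (i : ℤ) : 0 ≤ π i := mul_nonneg (hwpos i).le (inv_pos.2 hZ).le
  have hone : HasSum π 1 := by
    have := hw.mul_right (1 + p₁ + p₂)⁻¹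
    rwa [mul_inv_cancel₀ hZ.ne'] at this
  have hflow : Summable fun i => π i * queueBirthRate α γ i := by
    refine (hmoment (A := α * (p₁ + 1))
      (B := α * (p₂ + 1) + γ * ((β - α) / γ * p₂ + β / γ)) ?_ ?_).summable
    · simpa only [queueBirthRate_natCast] using hr₁.mul_left α
    · refine ((hr₂.mul_left α).add (hm₂.mul_left γ)).congr_fun fun n => ?_
      rw [queueBirthRate_neg_natCast]
      ring
  have hbal (i : ℤ) : π i * queueBirthRate α γ i = π (i + 1) * queueDeathRate β θ (i + 1) := by
    have := queueWeight_balance hα hβ hθ hγ i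
    simp only [hπ]
    rw [mul_right_comm, this]
    ring
  have hstat : IsStationaryDistribution P π :=
    ⟨hnonneg, hone, hasSum_stationary_of_balance hP hQ (fun i => (hb i).le) hnonneg
      hone.summable hflow hbal⟩
  have hfirst : Summable fun i : ℤ => |(i : ℝ)| * π i := by
    refine (hmoment (g := fun i => |(i : ℝ)|) (A := (α - β) / θ * p₁ + α / θ)
      (B := (β - α) / γ * p₂ + β / γ) ?_ ?_).summable.congr fun i => mul_comm _ _
    · simpa using hm₁
    · simpa using hm₂
  have hlim : IsLimitingDistribution P π :=
    ⟨hnonneg, hone, tendsto_transition_of_contraction hstat hfirst (lt_min hθ hγ)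
      (abs_queue_transition_sub_le hα hβ hθ hγ hP hQ)⟩
  obtain ⟨B, hB⟩ := exists_moment_bound hα hβ hθ hγ hP hQ two_ne_zero even_two exists_sq_drift
  obtain ⟨B', hB'⟩ := exists_moment_bound hα hβ hθ hγ hP hQ four_ne_zero ⟨2, rfl⟩
    exists_pow_four_drift
  have hlimit {g : ℤ → ℝ} {A : ℝ} (hg : ∀ j, |g j| ≤ (j : ℝ) ^ 2)
      (hA : HasSum (fun i => π i * g i) A) :
      Tendsto (fun t => ∫ ω, g (X t ω) ∂ℙ) atTop (𝓝 A) := by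
    rw [← hA.tsum_eq]
    exact tendsto_integral_of_le_sq hP hX hX0 hlim hB hB' hg
  have hcases (j : ℤ) : ∃ n : ℕ, (j = n ∨ j = -n) ∧ (n : ℝ) ≤ n ^ 2 := by
    obtain ⟨n, hn⟩ := j.eq_nat_or_neg
    exact ⟨n, hn, by exact_mod_cast Nat.le_self_pow two_ne_zero n⟩
  refine ⟨π, hstat, fun π' h => h.eq_of_isLimitingDistribution hP hlim, hlim, hZ.ne', hπ0,
    fun t => (integrable_and_hasSum_integral hP hX hX0 hB (g := fun j => (j : ℝ) ^ 2)
      (fun j => (abs_of_nonneg (sq_nonneg _)).le) t).1, _, _, rfl, rfl, ?_, ?_, ?_, ?_⟩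
  · refine hlimit (g := fun j => ((j⁺ : ℤ) : ℝ)) (fun j => ?_) ?_
    · obtain ⟨n, rfl | rfl, hn⟩ := hcases j <;> simp [hn]
    · have := hmoment (g := fun j => ((j⁺ : ℤ) : ℝ)) (B := 0) (by simpa using hm₁) (by simp)
      simpa using this
  · refine hlimit (g := fun j => ((j⁻ : ℤ) : ℝ)) (fun j => ?_) ?_
    · obtain ⟨n, rfl | rfl, hn⟩ := hcases j <;> simp [hn]
    · have := hmoment (g := fun j => ((j⁻ : ℤ) : ℝ)) (A := 0) (by simp) (by simpa using hm₂)
      simpa using this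
  · refine hlimit (g := fun j => ((j⁺ : ℤ) : ℝ) ^ 2) (fun j => ?_) ?_
    · obtain ⟨n, rfl | rfl, hn⟩ := hcases j <;> simp
    · have := hmoment (g := fun j => ((j⁺ : ℤ) : ℝ) ^ 2) (B := 0) (by simpa using hs₁) (by simp)
      convert this using 1
      simp
      ring
  · refine hlimit (g := fun j => ((j⁻ : ℤ) : ℝ) ^ 2) (fun j => ?_) ?_
    · obtain ⟨n, rfl | rfl, hn⟩ := hcases j <;> simp
    · have := hmoment (g := fun j => ((j⁻ : ℤ) : ℝ) ^ 2) (A := 0) (by simp) (by simpa using hs₂)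
      convert this using 1
      simp
      ring
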